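/- Consider an $M/M/N$ queue ($N\ge 1$) with Poisson arrivals of rate $\lambda>0$, FIFO service of delayed customers, and exponential service times, under Random routing: an arriving customer that finds idle servers is assigned to one of them chosen uniformly at random, and joins an infinite queue if all servers are busy. One tagged server works at rate $\mu_1$ and the other $N-1$ servers work at rate $\mu$, where $\mu>\lambda/N$ and $\mu_1>\underline{\mu}_1:=(\lambda-(N-1)\mu)^+$. The Markov chain that records the set of busy servers and the number of waiting customers then has exactly one stationary distribution; let $I(\mu_1)$ be the stationary probability that the tagged server is idle. For fixed $N,\lambda,\mu$, the function $I$ is three times continuously differentiable on $(\underline{\mu}_1,\infty)$, and its derivatives with respect to $\mu_1$ satisfy: (a) There is a threshold $\mu_1^\dagger\in[\underline{\mu}_1,\infty)$ such that $I''(\mu_1)>0$ for $\underline{\mu}_1<\mu_1<\mu_1^\dagger$, and $I''(\mu_1)<0$ for $\mu_1^\dagger<\mu_1<\infty$. (In particular $I$ is strictly convex on $(\underline{\mu}_1,\mu_1^\dagger)$ and strictly concave on $(\mu_1^\dagger,\infty)$; the first interval may be empty.) (b) For every $\mu_1>\underline{\mu}_1$, if $I''(\mu_1)>0$ then $I'''(\mu_1)<0$.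 -/

import Mathlib

/-- A state of an `M/M/N` system: the set `busy` of busy servers and the number `queue` of waiting
customers. Customers wait only when all servers are busy. -/
@[ext]
structure MMNState (N : ℕ) where
  busy : Finset (Fin N)
  queue : ℕ
  work_conserving : queue ≠ 0 → busy = Finset.univ

namespace MMNState

/-- An arriving customer starts service at server `i`. -/
def route {N : ℕ} (s : MMNState N) (i : Fin N) : MMNState N where
  busy := insert i s.busy
  queue := s.queue
  work_conserving := fun h => by rw [s.work_conserving h]; exact Finset.insert_eq_of_mem (Finset.mem_univ i)

/-- An arriving customer who finds all servers busy joins the queue. -/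
def enqueue {N : ℕ} (s : MMNState N) : MMNState N where
  busy := Finset.univ
  queue := s.queue + 1
  work_conserving := fun _ => rfl

/-- Server `i` completes a service: it becomes idle if nobody is waiting, and otherwise immediately
takes the next waiting customer. -/
def complete {N : ℕ} (s : MMNState N) (i : Fin N) : MMNState N where
  busy := if s.queue = 0 then s.busy.erase i else Finset.univ
  queue := s.queue - 1
  work_conserving := fun h => if_neg (by omega)

end MMNState

open Classical in
/-- Rate of the transition from `s` to `s'` in the `M/M/N` system with arrival rate `lam`, in which
server `i` works at rate `r i`. Random routing: an arriving customer goes to one of the idle servers,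
chosen uniformly at random; if there is none, the customer joins the queue. -/
noncomputable def mmnRate {N : ℕ} (lam : ℝ) (r : Fin N → ℝ) (s s' : MMNState N) : ℝ :=
  (if s.busy = Finset.univ then (if s' = s.enqueue then lam else 0)
    else ∑ i ∈ s.busyᶜ, if s' = s.route i then lam / (s.busyᶜ.card : ℝ) else 0)
  + ∑ i ∈ s.busy, if s' = s.complete i then r i else 0

/-- `p` is a stationary distribution of the continuous-time Markov chain on `S` with transition rates
`q`: a probability distribution for which in every state the total flow in equals the total flow
out. -/
structure IsStationaryDistribution {S : Type*} (q : S → S → ℝ) (p : S → ℝ) : Prop where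
  nonneg : ∀ s, 0 ≤ p s
  hasSum_one : HasSum p 1
  balance : ∀ s, HasSum (fun s' => p s' * q s' s) (p s * ∑' s', q s s')

/-- The stationary distribution of a continuous-time Markov chain (meaningful if there is exactly
one). -/
noncomputable def stationaryDistribution {S : Type*} (q : S → S → ℝ) : S → ℝ :=
  Classical.epsilon (IsStationaryDistribution q)

open Classical in
/-- Steady-state probability that server `i` is idle in the `M/M/N` system with Random routing. -/
noncomputable def mmnIdle {N : ℕ} (lam : ℝ) (r : Fin N → ℝ) (i : Fin N) : ℝ :=
  ∑' s : MMNState N, if i ∈ s.busy then 0 else stationaryDistribution (mmnRate lam r) s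

/-- Service rates when the tagged server `i` works at rate `x` and all others at rate `mu`. -/
def taggedRates {N : ℕ} (i : Fin N) (mu x : ℝ) : Fin N → ℝ :=
  Function.update (fun _ => mu) i x

/-- Idle time of the tagged server `i` as a function of its own rate `x`. -/
noncomputable def taggedIdle {N : ℕ} (lam mu : ℝ) (i : Fin N) (x : ℝ) : ℝ :=
  mmnIdle lam (taggedRates i mu x) i

/-- The smallest rate of the tagged server, `(lam - (N - 1) mu)⁺`, above which the system is stable. -/
noncomputable def taggedRateInf (N : ℕ) (lam mu : ℝ) : ℝ :=
  max (lam - ((N : ℝ) - 1) * mu) 0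

/-! The chain is reversible. A busy set `B` with `n` waiting customers has weight `|Bᶜ|! * ∏ i ∈ B,
lam / r i * (lam / ∑ r) ^ n`, which satisfies detailed balance; it is summable when `lam < ∑ r`, and
irreducibility makes the normalised weight the only stationary distribution.

Only the factor `1 / x` of the tagged server and the geometric tail depend on `x`. With `y = x - c`
and `c = lam - (N - 1) * mu`, the idle probability is therefore `x y / (x y + b y + e)` with `b, e >
0` (`exists_taggedIdle_eq`). In the variable `t = x - max c 0` both signs of `c` give `t (t + g) /
(t² + (b + g) t + d)` with `b, d > 0` and `g ≥ 0`.

Write `Q` for this denominator. The first three derivatives are `P₁ / Q²`, `-2 P₂ / Q³` and `6 (Q'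
P₂ - Q P₁) / Q⁴`, where `P₂` is a cubic with `P₂' = 3 P₁ > 0` for `t > 0`. So `P₂` changes sign at
most once, from negative to positive, which gives the threshold; and `P₂ ≤ 0` forces a negative
third derivative (`rational_idle_shape`). -/

/-! ### Uniqueness and reversibility for general chains. -/

/-- Two stationary distributions of a chain with bounded rates coincide when every nonempty set of
states that contains all predecessors of its members is the whole state space. -/
theorem IsStationaryDistribution.eq_of_irreducible {S : Type*} {q : S → S → ℝ} {C : ℝ}
    (hq : ∀ s s', 0 ≤ q s s') (hs : ∀ s, Summable (q s)) (hC : ∀ s, ∑' s', q s s' ≤ C)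
    (hirr : ∀ Z : Set S, Z.Nonempty → (∀ s ∈ Z, ∀ s', 0 < q s' s → s' ∈ Z) → Z = Set.univ)
    {p p' : S → ℝ} (hp : IsStationaryDistribution q p) (hp' : IsStationaryDistribution q p') :
    p = p' := by
  -- The pointwise minimum has inflow at most outflow in every state. Its total inflow and total
  -- outflow agree and are finite because rates are bounded, so it is balanced everywhere.
  set w : S → ℝ := fun s => min (p s) (p' s) with hw
  have hw0 : ∀ s, 0 ≤ w s := fun s => le_min (hp.nonneg s) (hp'.nonneg s)
  have hwp : ∀ s, w s ≤ p s := fun s => min_le_left _ _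
  have hwp' : ∀ s, w s ≤ p' s := fun s => min_le_right _ _
  have hwsum : Summable w := hp.hasSum_one.summable.of_nonneg_of_le hw0 hwp
  have hout0 : ∀ s, 0 ≤ ∑' s', q s s' := fun s => tsum_nonneg (hq s)
  have hin : ∀ s, Summable (fun s' => w s' * q s' s) := fun s =>
    (hp.balance s).summable.of_nonneg_of_le (fun s' => mul_nonneg (hw0 s') (hq s' s))
      (fun s' => mul_le_mul_of_nonneg_right (hwp s') (hq s' s))
  have hle : ∀ s, ∑' s', w s' * q s' s ≤ w s * ∑' s', q s s' := by
    intro s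
    have h1 : ∑' s', w s' * q s' s ≤ p s * ∑' s', q s s' :=
      hasSum_le (fun s' => mul_le_mul_of_nonneg_right (hwp s') (hq s' s))
        (hin s).hasSum (hp.balance s)
    have h2 : ∑' s', w s' * q s' s ≤ p' s * ∑' s', q s s' :=
      hasSum_le (fun s' => mul_le_mul_of_nonneg_right (hwp' s') (hq s' s))
        (hin s).hasSum (hp'.balance s)
    rcases min_choice (p s) (p' s) with h | h
    · simpa [hw, h] using h1
    · simpa [hw, h] using h2
  have hflow : Summable (fun s => w s * ∑' s', q s s') :=
    (hwsum.mul_right C).of_nonneg_of_le (fun s => mul_nonneg (hw0 s) (hout0 s))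
      (fun s => mul_le_mul_of_nonneg_left (hC s) (hw0 s))
  have hprod : Summable (fun z : S × S => w z.1 * q z.1 z.2) := by
    rw [summable_prod_of_nonneg (fun z => mul_nonneg (hw0 z.1) (hq z.1 z.2))]
    refine ⟨fun s => (hs s).mul_left (w s), ?_⟩
    simpa only [tsum_mul_left] using hflow
  have htot : ∑' s, ∑' s', w s' * q s' s = ∑' s, w s * ∑' s', q s s' := by
    rw [Summable.tsum_comm (f := fun s' s => w s' * q s' s) hprod]
    simp only [tsum_mul_left]
  have hinflow : Summable (fun s => ∑' s', w s' * q s' s) :=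
    hflow.of_nonneg_of_le (fun s => tsum_nonneg fun s' => mul_nonneg (hw0 s') (hq s' s)) hle
  have heq : ∀ s, ∑' s', w s' * q s' s = w s * ∑' s', q s s' := by
    intro s
    by_contra hne
    have := hasSum_lt hle (lt_of_le_of_ne (hle s) hne) hinflow.hasSum hflow.hasSum
    exact this.ne htot
  -- The set `p = w` is nonempty, since otherwise `p' < p` everywhere although both sum to 1. It
  -- contains predecessors: where `p = w`, the inflows of `p` and `w` agree, hence agree term by
  -- term.
  have hvan : (fun s => p s = w s) = fun _ => True := by
    refine hirr {s | p s = w s} ?_ ?_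
    · by_contra hemp
      rw [Set.not_nonempty_iff_eq_empty, Set.eq_empty_iff_forall_notMem] at hemp
      have hlt : ∀ s, p' s < p s := by
        intro s
        by_contra h
        exact hemp s (min_eq_left (not_lt.1 h)).symm
      have hne : Nonempty S := by
        by_contra h
        rw [not_nonempty_iff] at h
        have := hp.hasSum_one.unique (hasSum_empty)
        exact one_ne_zero this
      obtain ⟨s⟩ := hne
      exact (hasSum_lt (fun s => (hlt s).le) (hlt s) hp'.hasSum_one hp.hasSum_one).ne rfl
    · intro s (hsw : p s = w s) s' hq'
      by_contra hne
      have hlt : w s' < p s' := lt_of_le_of_ne (hwp s') (fun h => hne h.symm)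
      have := hasSum_lt (fun s' => mul_le_mul_of_nonneg_right (hwp s') (hq s' s))
        (mul_lt_mul_of_pos_right hlt hq') (hin s).hasSum (hp.balance s)
      rw [heq s, hsw] at this
      exact this.ne rfl
  have hpp' : ∀ s, p s ≤ p' s := fun s => by
    have : p s = w s := by
      have := congrFun hvan s
      simpa using this
    rw [this]
    exact hwp' s
  funext s
  by_contra hne
  exact (hasSum_lt hpp' (lt_of_le_of_ne (hpp' s) hne) hp.hasSum_one hp'.hasSum_one).ne rfl

/-- A probability distribution in detailed balance with the transition rates is stationary. -/
theorem IsStationaryDistribution.of_detailed_balance {S : Type*} {q : S → S → ℝ} {p : S → ℝ}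
    (hs : ∀ s, Summable (q s)) (hp : ∀ s, 0 ≤ p s) (h1 : HasSum p 1)
    (hdb : ∀ s s', p s * q s s' = p s' * q s' s) : IsStationaryDistribution q p where
  nonneg := hp
  hasSum_one := h1
  balance s := by
    simp only [fun s' => hdb s' s]
    exact (hs s).hasSum.mul_left (p s)

/-! ### Combinatorics of states and transitions. -/

namespace MMNState

variable {N : ℕ}

/-- The state with busy set `B` and no waiting customers. -/
def ofBusy (B : Finset (Fin N)) : MMNState N where
  busy := B
  queue := 0
  work_conserving := fun h => absurd rfl h

/-- The state with `n` waiting customers and all servers busy. -/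
def ofQueue (N n : ℕ) : MMNState N where
  busy := Finset.univ
  queue := n
  work_conserving := fun _ => rfl

/-- States are either busy sets without waiting customers, or queues of positive length. -/
def sumEquiv (N : ℕ) : Finset (Fin N) ⊕ ℕ ≃ MMNState N where
  toFun := Sum.elim ofBusy (fun n => ofQueue N (n + 1))
  invFun s := if s.queue = 0 then Sum.inl s.busy else Sum.inr (s.queue - 1)
  left_inv := by rintro (B | n) <;> simp [ofBusy, ofQueue]
  right_inv := by
    intro s
    by_cases h : s.queue = 0
    · ext1 <;> simp [h, ofBusy]
    · ext1
      · simp [h, ofQueue, s.work_conserving h]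
      · simp only [h, if_false, Sum.elim_inr, ofQueue]
        omega

theorem queue_eq_zero {s : MMNState N} (h : s.busy ≠ Finset.univ) : s.queue = 0 := by
  by_contra h'
  exact h (s.work_conserving h')

/-- `s` arises from routing a customer to the idle server `i` exactly when `i` completing a service
leads back. -/
theorem route_iff_complete {s s' : MMNState N} (h : s.busy ≠ Finset.univ) (i : Fin N) :
    (i ∈ s.busyᶜ ∧ s' = s.route i) ↔ (i ∈ s'.busy ∧ s = s'.complete i) := by
  have hq := queue_eq_zero h
  constructor
  · rintro ⟨hi, rfl⟩
    rw [Finset.mem_compl] at hi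
    refine ⟨by simp [route], ?_⟩
    ext1
    · simp [complete, route, hq, hi]
    · simp [complete, route, hq]
  · rintro ⟨hi, rfl⟩
    have hq' : s'.queue = 0 := by
      by_contra h'
      exact h (by simp [complete, h'])
    refine ⟨by simp [complete, hq'], ?_⟩
    ext1
    · simp [complete, route, hq', hi]
    · simp [complete, route, hq']

theorem eq_enqueue_iff {s s' : MMNState N} (h : s.busy = Finset.univ) {i : Fin N}
    (hi : i ∈ s'.busy) : s = s'.complete i ↔ s' = s.enqueue := by
  constructor
  · intro hs
    have hq : s'.queue ≠ 0 := by
      intro hq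
      have : i ∉ s.busy := by simp [hs, complete, hq]
      exact this (h ▸ Finset.mem_univ i)
    ext1
    · simp [enqueue, s'.work_conserving hq]
    · rw [hs]
      simp only [enqueue, complete]
      omega
  · rintro rfl
    ext1
    · simp [complete, enqueue, h]
    · simp [complete, enqueue]

end MMNState

/-! ### Transition rates and irreducibility. -/

open Classical in
/-- Rate at which an arrival takes `s` to `s'`. -/
noncomputable def mmnArrivalRate {N : ℕ} (lam : ℝ) (s s' : MMNState N) : ℝ :=
  if s.busy = Finset.univ then (if s' = s.enqueue then lam else 0)
    else ∑ i ∈ s.busyᶜ, if s' = s.route i then lam / (s.busyᶜ.card : ℝ) else 0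

open Classical in
/-- Rate at which a service completion takes `s` to `s'`. -/
noncomputable def mmnServiceRate {N : ℕ} (r : Fin N → ℝ) (s s' : MMNState N) : ℝ :=
  ∑ i ∈ s.busy, if s' = s.complete i then r i else 0

theorem mmnRate_eq {N : ℕ} (lam : ℝ) (r : Fin N → ℝ) (s s' : MMNState N) :
    mmnRate lam r s s' = mmnArrivalRate lam s s' + mmnServiceRate r s s' := rfl

theorem hasSum_mmnArrivalRate {N : ℕ} (lam : ℝ) (s : MMNState N) :
    HasSum (mmnArrivalRate lam s) lam := by
  classical
  unfold mmnArrivalRate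
  by_cases h : s.busy = Finset.univ
  · simp only [h, if_true]
    convert hasSum_ite_eq s.enqueue lam
  · simp only [h, if_false]
    have hcard : (s.busyᶜ.card : ℝ) ≠ 0 := by simpa using h
    have h1 : HasSum (fun s' : MMNState N => ∑ i ∈ s.busyᶜ,
        if s' = s.route i then lam / (s.busyᶜ.card : ℝ) else 0)
        (∑ i ∈ s.busyᶜ, lam / (s.busyᶜ.card : ℝ)) :=
      hasSum_sum fun i _ => hasSum_ite_eq (s.route i) _
    rw [Finset.sum_const, nsmul_eq_mul, mul_div_cancel₀ _ hcard] at h1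
    convert h1

theorem hasSum_mmnServiceRate {N : ℕ} (r : Fin N → ℝ) (s : MMNState N) :
    HasSum (mmnServiceRate r s) (∑ i ∈ s.busy, r i) := by
  classical
  unfold mmnServiceRate
  convert hasSum_sum (fun i _ => hasSum_ite_eq (s.complete i) (r i))

theorem hasSum_mmnRate {N : ℕ} (lam : ℝ) (r : Fin N → ℝ) (s : MMNState N) :
    HasSum (mmnRate lam r s) (lam + ∑ i ∈ s.busy, r i) :=
  (hasSum_mmnArrivalRate lam s).add (hasSum_mmnServiceRate r s)

section Positive

variable {N : ℕ} {lam : ℝ} {r : Fin N → ℝ}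

theorem mmnArrivalRate_nonneg (hlam : 0 < lam) (s s' : MMNState N) :
    0 ≤ mmnArrivalRate lam s s' := by
  unfold mmnArrivalRate
  split_ifs
  · exact hlam.le
  · exact le_rfl
  · exact Finset.sum_nonneg fun i _ => by split_ifs <;> positivity

theorem mmnServiceRate_nonneg (hr : ∀ i, 0 < r i) (s s' : MMNState N) :
    0 ≤ mmnServiceRate r s s' :=
  Finset.sum_nonneg fun i _ => by split_ifs; exacts [(hr i).le, le_rfl]

theorem mmnRate_nonneg (hlam : 0 < lam) (hr : ∀ i, 0 < r i) (s s' : MMNState N) :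
    0 ≤ mmnRate lam r s s' :=
  add_nonneg (mmnArrivalRate_nonneg hlam s s') (mmnServiceRate_nonneg hr s s')

theorem mmnRate_pos_of_complete (hlam : 0 < lam) (hr : ∀ i, 0 < r i) {s : MMNState N} {i : Fin N}
    (hi : i ∈ s.busy) : 0 < mmnRate lam r s (s.complete i) := by
  refine add_pos_of_nonneg_of_pos (mmnArrivalRate_nonneg hlam _ _) ?_
  refine Finset.sum_pos' (fun j _ => by split_ifs; exacts [(hr j).le, le_rfl]) ⟨i, hi, ?_⟩
  rw [if_pos rfl]
  exact hr i

theorem mmnRate_pos_of_enqueue (hlam : 0 < lam) (hr : ∀ i, 0 < r i) {s : MMNState N}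
    (h : s.busy = Finset.univ) : 0 < mmnRate lam r s s.enqueue := by
  refine add_pos_of_pos_of_nonneg ?_ (mmnServiceRate_nonneg hr _ _)
  simpa [mmnArrivalRate, h] using hlam

theorem mmnRate_pos_of_route (hlam : 0 < lam) (hr : ∀ i, 0 < r i) {s : MMNState N} {i : Fin N}
    (hi : i ∉ s.busy) : 0 < mmnRate lam r s (s.route i) := by
  classical
  refine add_pos_of_pos_of_nonneg ?_ (mmnServiceRate_nonneg hr _ _)
  have h : s.busy ≠ Finset.univ := fun h => hi (h ▸ Finset.mem_univ i)
  have hi' : i ∈ s.busyᶜ := Finset.mem_compl.2 hi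
  have hcard : 0 < s.busyᶜ.card := Finset.card_pos.2 ⟨i, hi'⟩
  rw [if_neg h]
  refine Finset.sum_pos' (fun j _ => by split_ifs <;> positivity) ⟨i, hi', ?_⟩
  rw [if_pos rfl]
  positivity

/-- Going backwards, arrivals lead from any state down to the empty system; from there, backward
service completions reach every busy set and then every queue length. -/
theorem mmn_irreducible [NeZero N] (hlam : 0 < lam) (hr : ∀ i, 0 < r i) (Z : Set (MMNState N))
    (hne : Z.Nonempty) (hZ : ∀ s ∈ Z, ∀ s', 0 < mmnRate lam r s' s → s' ∈ Z) : Z = Set.univ := by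
  classical
  have hqueue : ∀ n, MMNState.ofQueue N n ∈ Z → MMNState.ofQueue N 0 ∈ Z := by
    intro n
    induction n with
    | zero => exact id
    | succ n ih =>
      intro h
      exact ih (hZ _ h _ (mmnRate_pos_of_enqueue hlam hr rfl))
  have hbusy : ∀ B : Finset (Fin N), MMNState.ofBusy B ∈ Z → MMNState.ofBusy ∅ ∈ Z := by
    intro B
    induction B using Finset.induction_on with
    | empty => exact id
    | insert i B hi ih =>
      intro h
      exact ih (hZ _ h _ (mmnRate_pos_of_route hlam hr (s := MMNState.ofBusy B) hi))
  have hempty : MMNState.ofBusy ∅ ∈ Z := by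
    obtain ⟨s, hs⟩ := hne
    obtain ⟨t, rfl⟩ := (MMNState.sumEquiv N).surjective s
    rcases t with B | n
    · exact hbusy B hs
    · exact hbusy Finset.univ (hqueue _ hs)
  have hbusy' : ∀ B : Finset (Fin N), MMNState.ofBusy B ∈ Z := by
    intro B
    induction B using Finset.induction_on with
    | empty => exact hempty
    | insert i B hi ih =>
      refine hZ _ ih _ ?_
      have h := mmnRate_pos_of_complete hlam hr (s := MMNState.ofBusy (insert i B))
        (Finset.mem_insert_self i B)
      have hs : (MMNState.ofBusy (insert i B)).complete i = MMNState.ofBusy B := by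
        ext1 <;> simp [MMNState.complete, MMNState.ofBusy, hi]
      rwa [hs] at h
  have hqueue' : ∀ n, MMNState.ofQueue N n ∈ Z := by
    intro n
    induction n with
    | zero => exact hbusy' Finset.univ
    | succ n ih =>
      refine hZ _ ih _ ?_
      have h := mmnRate_pos_of_complete hlam hr (s := MMNState.ofQueue N (n + 1)) (i := 0)
        (Finset.mem_univ 0)
      have hs : (MMNState.ofQueue N (n + 1)).complete 0 = MMNState.ofQueue N n := by
        ext1 <;> simp [MMNState.complete, MMNState.ofQueue]
      rwa [hs] at h
  refine Set.eq_univ_of_forall fun s => ?_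
  obtain ⟨t, rfl⟩ := (MMNState.sumEquiv N).surjective s
  rcases t with B | n
  exacts [hbusy' B, hqueue' _]

end Positive

/-! ### The product-form stationary distribution. -/

/-- Product-form weight of a busy set. -/
noncomputable def mmnBusyWeight {N : ℕ} (lam : ℝ) (r : Fin N → ℝ) (B : Finset (Fin N)) : ℝ :=
  (Bᶜ.card.factorial : ℝ) * ∏ i ∈ B, lam / r i

/-- Product-form weight of a state. -/
noncomputable def mmnWeight {N : ℕ} (lam : ℝ) (r : Fin N → ℝ) (s : MMNState N) : ℝ :=
  mmnBusyWeight lam r s.busy * (lam / ∑ i, r i) ^ s.queue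

section Weight

variable {N : ℕ} {lam : ℝ} {r : Fin N → ℝ}

theorem mmnBusyWeight_pos (hlam : 0 < lam) (hr : ∀ i, 0 < r i) (B : Finset (Fin N)) :
    0 < mmnBusyWeight lam r B :=
  mul_pos (by positivity) (Finset.prod_pos fun i _ => div_pos hlam (hr i))

/-- The factorial is chosen to absorb the uniform routing probability `1 / |Bᶜ|`. -/
theorem mmnBusyWeight_insert {B : Finset (Fin N)} {i : Fin N} (hi : i ∉ B) :
    mmnBusyWeight lam r (insert i B) * (Bᶜ.card : ℝ) = mmnBusyWeight lam r B * (lam / r i) := by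
  have h1 : (insert i B)ᶜ = Bᶜ.erase i := by rw [Finset.compl_insert]
  have h2 : Bᶜ.card = (Bᶜ.erase i).card + 1 :=
    (Finset.card_erase_add_one (Finset.mem_compl.2 hi)).symm
  rw [mmnBusyWeight, mmnBusyWeight, Finset.prod_insert hi, h1, h2, Nat.factorial_succ]
  push_cast
  ring

/-- Arrivals and completions reverse each other. When all servers are busy, every completion in the
enqueued state leads back, at total rate `∑ i, r i`, whence the geometric factor; otherwise the two
sums match server by server. -/
theorem mmnWeight_arrival_eq_service (hr : ∀ i, 0 < r i) (hsum : 0 < ∑ i, r i)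
    (s s' : MMNState N) :
    mmnWeight lam r s * mmnArrivalRate lam s s' = mmnWeight lam r s' * mmnServiceRate r s' s := by
  classical
  unfold mmnArrivalRate mmnServiceRate
  by_cases h : s.busy = Finset.univ
  · rw [if_pos h, Finset.sum_congr rfl
      (fun i hi => if_congr (MMNState.eq_enqueue_iff (s := s) h hi) rfl rfl)]
    by_cases hs : s' = s.enqueue
    · subst hs
      simp only [if_true, mmnWeight, MMNState.enqueue, h, pow_succ]
      field_simp
    · simp [hs]
  · have hcard : (s.busyᶜ.card : ℝ) ≠ 0 := by simpa using h
    rw [if_neg h, Finset.mul_sum, Finset.mul_sum, ← Finset.sum_filter_add_sum_filter_not s.busyᶜ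
      (fun i => s' = s.route i), ← Finset.sum_filter_add_sum_filter_not s'.busy
      (fun i => s = s'.complete i)]
    have hz1 : ∑ i ∈ s.busyᶜ with ¬ s' = s.route i, mmnWeight lam r s *
        (if s' = s.route i then lam / (s.busyᶜ.card : ℝ) else 0) = 0 :=
      Finset.sum_eq_zero fun i hi => by rw [if_neg (Finset.mem_filter.1 hi).2, mul_zero]
    have hz2 : ∑ i ∈ s'.busy with ¬ s = s'.complete i, mmnWeight lam r s' *
        (if s = s'.complete i then r i else 0) = 0 :=
      Finset.sum_eq_zero fun i hi => by rw [if_neg (Finset.mem_filter.1 hi).2, mul_zero]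
    rw [hz1, hz2, add_zero, add_zero]
    refine Finset.sum_congr ?_ ?_
    · ext i
      simpa only [Finset.mem_filter] using MMNState.route_iff_complete h i
    · intro i hi
      obtain ⟨hi1, hi2⟩ := Finset.mem_filter.1 hi
      have hs := (MMNState.route_iff_complete h i).2 ⟨hi1, hi2⟩
      rw [if_pos hi2, if_pos hs.2]
      have hib : i ∉ s.busy := Finset.mem_compl.1 hs.1
      have hw := mmnBusyWeight_insert (lam := lam) (r := r) hib
      have hri := (hr i).ne'
      rw [hs.2]
      simp only [mmnWeight, MMNState.route, MMNState.queue_eq_zero h, pow_zero, mul_one]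
      field_simp at hw ⊢
      linarith

theorem mmnWeight_detailed_balance (hr : ∀ i, 0 < r i) (hsum : 0 < ∑ i, r i)
    (s s' : MMNState N) :
    mmnWeight lam r s * mmnRate lam r s s' = mmnWeight lam r s' * mmnRate lam r s' s := by
  rw [mmnRate_eq, mmnRate_eq, mul_add, mul_add, mmnWeight_arrival_eq_service hr hsum s s',
    mmnWeight_arrival_eq_service hr hsum s' s, add_comm]

/-- Total weight of all states. -/
noncomputable def mmnTotalWeight (lam : ℝ) (r : Fin N → ℝ) : ℝ :=
  ∑ B, mmnBusyWeight lam r B + mmnBusyWeight lam r Finset.univ * (lam / (∑ i, r i - lam))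

theorem hasSum_mmnWeight (hlam : 0 < lam) (hstab : lam < ∑ i, r i) :
    HasSum (mmnWeight lam r) (mmnTotalWeight lam r) := by
  rw [← (MMNState.sumEquiv N).hasSum_iff]
  have hsum : 0 < ∑ i, r i := hlam.trans hstab
  refine HasSum.sum ?_ ?_
  · convert hasSum_fintype (fun B : Finset (Fin N) => mmnBusyWeight lam r B) using 1
    ext B
    simp [mmnWeight, MMNState.sumEquiv, MMNState.ofBusy]
  · have hg := (hasSum_geometric_of_lt_one (div_pos hlam hsum).le
      ((div_lt_one hsum).2 hstab)).mul_left (mmnBusyWeight lam r Finset.univ * (lam / ∑ i, r i))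
    have hne : ∑ i, r i - lam ≠ 0 := (sub_pos.2 hstab).ne'
    have e1 : mmnBusyWeight lam r Finset.univ * (lam / (∑ i, r i - lam)) =
        mmnBusyWeight lam r Finset.univ * (lam / ∑ i, r i) * (1 - lam / ∑ i, r i)⁻¹ := by
      rw [one_sub_div hsum.ne', inv_div]
      field_simp
    have e2 : (mmnWeight lam r ∘ MMNState.sumEquiv N) ∘ Sum.inr = fun n : ℕ =>
        mmnBusyWeight lam r Finset.univ * (lam / ∑ i, r i) * (lam / ∑ i, r i) ^ n := by
      ext n
      simp only [mmnWeight, MMNState.sumEquiv, MMNState.ofQueue, Function.comp, Equiv.coe_fn_mk,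
        Sum.elim_inr, pow_succ]
      ring
    rw [e1, e2]
    exact hg

theorem mmnTotalWeight_pos (hlam : 0 < lam) (hr : ∀ i, 0 < r i) (hstab : lam < ∑ i, r i) :
    0 < mmnTotalWeight lam r :=
  add_pos_of_nonneg_of_pos (Finset.sum_nonneg fun B _ => (mmnBusyWeight_pos hlam hr B).le)
    (mul_pos (mmnBusyWeight_pos hlam hr _) (div_pos hlam (sub_pos.2 hstab)))

theorem isStationaryDistribution_mmnWeight (hlam : 0 < lam) (hr : ∀ i, 0 < r i)
    (hstab : lam < ∑ i, r i) :
    IsStationaryDistribution (mmnRate lam r)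
      (fun s => mmnWeight lam r s / mmnTotalWeight lam r) := by
  have hsum : 0 < ∑ i, r i := hlam.trans hstab
  have hW := mmnTotalWeight_pos hlam hr hstab
  refine .of_detailed_balance (fun s => (hasSum_mmnRate lam r s).summable) (fun s => ?_) ?_ ?_
  · exact div_nonneg (mul_nonneg (mmnBusyWeight_pos hlam hr _).le
      (pow_nonneg (div_pos hlam hsum).le _)) hW.le
  · simpa [hW.ne'] using (hasSum_mmnWeight hlam hstab).div_const (mmnTotalWeight lam r)
  · intro s s'
    rw [div_mul_eq_mul_div, div_mul_eq_mul_div, mmnWeight_detailed_balance hr hsum s s']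

theorem mmn_stationary_eq [NeZero N] (hlam : 0 < lam) (hr : ∀ i, 0 < r i)
    (hstab : lam < ∑ i, r i) {p : MMNState N → ℝ} (hp : IsStationaryDistribution (mmnRate lam r) p) :
    p = fun s => mmnWeight lam r s / mmnTotalWeight lam r :=
  IsStationaryDistribution.eq_of_irreducible (C := lam + ∑ i, r i) (mmnRate_nonneg hlam hr)
    (fun s => (hasSum_mmnRate lam r s).summable)
    (fun s => by
      rw [(hasSum_mmnRate lam r s).tsum_eq, add_le_add_iff_left]
      exact Finset.sum_le_univ_sum_of_nonneg fun i => (hr i).le)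
    (mmn_irreducible hlam hr) hp (isStationaryDistribution_mmnWeight hlam hr hstab)

theorem mmn_existsUnique_stationary [NeZero N] (hlam : 0 < lam) (hr : ∀ i, 0 < r i)
    (hstab : lam < ∑ i, r i) : ∃! p, IsStationaryDistribution (mmnRate lam r) p :=
  ⟨_, isStationaryDistribution_mmnWeight hlam hr hstab,
    fun _ hp => mmn_stationary_eq hlam hr hstab hp⟩

theorem mmnIdle_eq [NeZero N] (hlam : 0 < lam) (hr : ∀ i, 0 < r i) (hstab : lam < ∑ i, r i)
    (i : Fin N) :
    mmnIdle lam r i =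
      (∑ B ∈ (Finset.univ.erase i).powerset, mmnBusyWeight lam r B) / mmnTotalWeight lam r := by
  classical
  have hstat : stationaryDistribution (mmnRate lam r) =
      fun s => mmnWeight lam r s / mmnTotalWeight lam r :=
    mmn_stationary_eq hlam hr hstab
      (Classical.epsilon_spec ⟨_, isStationaryDistribution_mmnWeight hlam hr hstab⟩)
  unfold mmnIdle
  rw [hstat, ← (MMNState.sumEquiv N).tsum_eq]
  refine HasSum.tsum_eq ?_
  -- The summand 0 is the contribution of states with a positive queue, where no server is idle.
  rw [← add_zero (_ / _)]
  refine HasSum.sum ?_ ?_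
  · convert hasSum_fintype _ using 1
    rw [Finset.sum_div, ← Finset.sum_subset (Finset.subset_univ (Finset.univ.erase i).powerset)]
    · refine Finset.sum_congr rfl fun B hB => ?_
      have hi : i ∉ B := fun h => by simpa using Finset.mem_powerset.1 hB h
      simp [MMNState.sumEquiv, MMNState.ofBusy, hi, mmnWeight]
    · intro B _ hB
      have hi : i ∈ B := by
        by_contra hi
        refine hB (Finset.mem_powerset.2 fun j hj => ?_)
        simp only [Finset.mem_erase, Finset.mem_univ, and_true]
        rintro rfl
        exact hi hj
      simp [MMNState.sumEquiv, MMNState.ofBusy, hi]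
  · convert hasSum_zero using 1
    ext n
    simp [MMNState.sumEquiv, MMNState.ofQueue]

end Weight

/-! ### Calculus of the rational idle function. -/

/-- A function which agrees on an open set with the head of a chain of derivatives has these as its
iterated derivatives there. -/
theorem iteratedDeriv_eqOn_of_chain {f f₀ f₁ f₂ f₃ : ℝ → ℝ} {U : Set ℝ} (hU : IsOpen U)
    (hf : Set.EqOn f f₀ U) (h₁ : ∀ x ∈ U, HasDerivAt f₀ (f₁ x) x)
    (h₂ : ∀ x ∈ U, HasDerivAt f₁ (f₂ x) x) (h₃ : ∀ x ∈ U, HasDerivAt f₂ (f₃ x) x) :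
    Set.EqOn (iteratedDeriv 2 f) f₂ U ∧ Set.EqOn (iteratedDeriv 3 f) f₃ U := by
  have step : ∀ {g g₀ g₁ : ℝ → ℝ}, Set.EqOn g g₀ U → (∀ x ∈ U, HasDerivAt g₀ (g₁ x) x) →
      Set.EqOn (deriv g) g₁ U := by
    intro g g₀ g₁ hg hg₁ x hx
    rw [(hg.eventuallyEq_of_mem (hU.mem_nhds hx)).deriv_eq, (hg₁ x hx).deriv]
  have e₂ : Set.EqOn (iteratedDeriv 2 f) f₂ U := by
    rw [iteratedDeriv_succ, iteratedDeriv_one]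
    exact step (step hf h₁) h₂
  exact ⟨e₂, by rw [iteratedDeriv_succ]; exact step e₂ h₃⟩

section RationalIdle

/-- Up to scaling, the numerator of the second derivative of `t (t + g) / (t² + (b + g) t + d)`. -/
def idleCubic (b d g t : ℝ) : ℝ :=
  b * t ^ 3 + 3 * d * t ^ 2 + 3 * d * g * t + d * (g * (b + g) - d)

variable {b d g : ℝ}

theorem idleCubic_strictMonoOn (hb : 0 < b) (hd : 0 < d) (hg : 0 ≤ g) :
    StrictMonoOn (idleCubic b d g) (Set.Ici 0) := by
  intro s (hs : 0 ≤ s) t _ hst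
  unfold idleCubic
  have h2 : s ^ 2 ≤ t ^ 2 := by gcongr
  have h3 : s ^ 3 < t ^ 3 := by gcongr
  have e1 := mul_lt_mul_of_pos_left h3 hb
  have e2 := mul_le_mul_of_nonneg_left h2 (by positivity : 0 ≤ 3 * d)
  have e3 := mul_le_mul_of_nonneg_left hst.le (by positivity : 0 ≤ 3 * d * g)
  linarith

theorem exists_idleCubic_threshold (hb : 0 < b) (hd : 0 < d) (hg : 0 ≤ g) :
    ∃ z, 0 ≤ z ∧ (∀ t, 0 < t → t < z → idleCubic b d g t < 0) ∧
      ∀ t, z < t → 0 < idleCubic b d g t := by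
  have hmono := idleCubic_strictMonoOn hb hd hg
  rcases le_or_gt 0 (idleCubic b d g 0) with h0 | h0
  · refine ⟨0, le_rfl, fun t h1 h2 => absurd h1 h2.not_gt, fun t ht => ?_⟩
    exact h0.trans_lt (hmono (Set.mem_Ici.2 le_rfl) (Set.mem_Ici.2 ht.le) ht)
  -- The only negative term of the cubic, `-d ^ 2`, is dominated by `3 * d * t ^ 2` at `t = d + 1`.
  · have hpos : 0 ≤ idleCubic b d g (d + 1) := by
      have h1 : idleCubic b d g (d + 1) = b * (d + 1) ^ 3 + 3 * d ^ 3 + 5 * d ^ 2 + 3 * d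
          + 3 * d * g * (d + 1) + d * g * (b + g) := by
        unfold idleCubic
        ring
      rw [h1]
      positivity
    have hcont : ContinuousOn (idleCubic b d g) (Set.Icc 0 (d + 1)) := by
      unfold idleCubic
      fun_prop
    obtain ⟨z, hz, hz0⟩ := intermediate_value_Icc (by positivity) hcont ⟨h0.le, hpos⟩
    refine ⟨z, hz.1, fun t h1 h2 => ?_, fun t ht => ?_⟩
    · rw [← hz0]
      exact hmono (Set.mem_Ici.2 h1.le) (Set.mem_Ici.2 hz.1) h2
    · rw [← hz0]
      exact hmono (Set.mem_Ici.2 hz.1) (Set.mem_Ici.2 (hz.1.trans ht.le)) ht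

/-- Shape of the idle time as a rational function of the service rate `x`, whose infimum is `m`. -/
theorem rational_idle_shape {f : ℝ → ℝ} {m : ℝ} (hb : 0 < b) (hd : 0 < d) (hg : 0 ≤ g)
    (hf : ∀ x, m < x → f x =
      (x - m) * (x - m + g) / ((x - m) ^ 2 + (b + g) * (x - m) + d)) :
    ContDiffOn ℝ 3 f (Set.Ioi m) ∧
    (∃ xd : ℝ, m ≤ xd ∧ (∀ x, m < x → x < xd → 0 < iteratedDeriv 2 f x) ∧
      (∀ x, xd < x → iteratedDeriv 2 f x < 0)) ∧
    (∀ x, m < x → 0 < iteratedDeriv 2 f x → iteratedDeriv 3 f x < 0) := by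
  set Q : ℝ → ℝ := fun x => (x - m) ^ 2 + (b + g) * (x - m) + d with hQ
  set P₁ : ℝ → ℝ := fun x => b * (x - m) ^ 2 + 2 * d * (x - m) + d * g with hP₁
  set P₂ : ℝ → ℝ := fun x => idleCubic b d g (x - m) with hP₂
  set Q' : ℝ → ℝ := fun x => 2 * (x - m) + (b + g) with hQ'
  have hQpos : ∀ x, m < x → 0 < Q x := fun x hx => by
    have := sub_pos.2 hx
    simp only [hQ]
    positivity
  have dt : ∀ x, HasDerivAt (fun x : ℝ => x - m) 1 x := fun x => (hasDerivAt_id x).sub_const m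
  have dQ : ∀ x, HasDerivAt Q (Q' x) x := fun x => by
    refine HasDerivAt.congr_deriv (((((dt x).pow 2).add ((dt x).const_mul (b + g))).add_const d)) ?_
    simp only [hQ']
    push_cast
    ring
  have dP₁ : ∀ x, HasDerivAt P₁ (2 * (b * (x - m) + d)) x := fun x => by
    refine HasDerivAt.congr_deriv ((((((dt x).pow 2).const_mul b).add ((dt x).const_mul (2 * d))).add_const (d * g))) ?_
    push_cast
    ring
  have dP₂ : ∀ x, HasDerivAt P₂ (3 * P₁ x) x := fun x => by
    refine HasDerivAt.congr_deriv (((((((dt x).pow 3).const_mul b).add (((dt x).pow 2).const_mul (3 * d))).add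
      ((dt x).const_mul (3 * d * g))).add_const (d * (g * (b + g) - d)))) ?_
    simp only [hP₁]
    push_cast
    ring
  have h₁ : ∀ x ∈ Set.Ioi m, HasDerivAt (fun x => (x - m) * (x - m + g) / Q x)
      (P₁ x / Q x ^ 2) x := fun x hx => by
    refine HasDerivAt.congr_deriv (((dt x).mul ((dt x).add_const g)).div (dQ x) (hQpos x hx).ne') ?_
    congr 1
    simp only [hP₁, hQ, hQ', Pi.mul_apply]
    ring
  have h₂ : ∀ x ∈ Set.Ioi m, HasDerivAt (fun x => P₁ x / Q x ^ 2)
      (-2 * P₂ x / Q x ^ 3) x := fun x hx => by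
    have hne := (hQpos x hx).ne'
    refine HasDerivAt.congr_deriv ((dP₁ x).div ((dQ x).pow 2) (pow_ne_zero 2 hne)) ?_
    -- Numerator of the quotient rule after cancelling `2 * Q x`; the quartic terms cancel and a
    -- cubic remains.
    have key : -P₂ x = (b * (x - m) + d) * Q x - P₁ x * Q' x := by
      simp only [hP₁, hP₂, hQ, hQ', idleCubic]
      ring
    push_cast
    field_simp
    linear_combination -key
  have h₃ : ∀ x ∈ Set.Ioi m, HasDerivAt (fun x => -2 * P₂ x / Q x ^ 3)
      (6 * (Q' x * P₂ x - Q x * P₁ x) / Q x ^ 4) x := fun x hx => by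
    have hne := (hQpos x hx).ne'
    refine HasDerivAt.congr_deriv (((dP₂ x).const_mul (-2)).div ((dQ x).pow 3) (pow_ne_zero 3 hne)) ?_
    push_cast
    field_simp
    ring
  obtain ⟨e₂, e₃⟩ := iteratedDeriv_eqOn_of_chain isOpen_Ioi (f := f) (fun x hx => hf x hx) h₁ h₂ h₃
  have neg_of : ∀ x, m < x → 0 < P₂ x → iteratedDeriv 2 f x < 0 := fun x hx h => by
    rw [e₂ hx]
    exact div_neg_of_neg_of_pos (by linarith) (pow_pos (hQpos x hx) 3)
  refine ⟨?_, ?_, ?_⟩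
  · refine ContDiffOn.congr (f := fun x => (x - m) * (x - m + g) / Q x) ?_ (fun x hx => hf x hx)
    refine ContDiffOn.div (by fun_prop) (by simp only [hQ]; fun_prop) fun x hx => (hQpos x hx).ne'
  · obtain ⟨z, hz, hlt, hgt⟩ := exists_idleCubic_threshold hb hd hg
    refine ⟨m + z, by linarith, fun x hx hxz => ?_, fun x hxz => ?_⟩
    · rw [e₂ hx]
      have : P₂ x < 0 := hlt (x - m) (by linarith) (by linarith)
      exact div_pos (by linarith) (pow_pos (hQpos x hx) 3)
    · exact neg_of x (by linarith) (hgt (x - m) (by linarith))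
  · intro x hx h
    -- Convexity at `x` gives this sign, which makes both terms of `Q' P₂ - Q P₁` nonpositive, the
    -- second strictly negative.
    have hP₂x : P₂ x ≤ 0 := by
      by_contra h'
      exact h.not_gt (neg_of x hx (not_le.1 h'))
    have ht := sub_pos.2 hx
    have hQ'x : 0 ≤ Q' x := by simp only [hQ']; positivity
    have hP₁x : 0 < P₁ x := by simp only [hP₁]; positivity
    rw [e₃ hx]
    refine div_neg_of_neg_of_pos ?_ (pow_pos (hQpos x hx) 4)
    have a1 := mul_nonpos_of_nonneg_of_nonpos hQ'x hP₂x
    have a2 := mul_pos (hQpos x hx) hP₁x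
    linarith

end RationalIdle

/-! ### Idle probability of the tagged server. -/

section Tagged

variable {N : ℕ} {lam mu x : ℝ} {i : Fin N}

theorem taggedRates_pos (hmu : 0 < mu) (hx : 0 < x) (j : Fin N) : 0 < taggedRates i mu x j := by
  unfold taggedRates
  rcases eq_or_ne j i with rfl | h
  · simpa using hx
  · simpa [h] using hmu

theorem sum_taggedRates : ∑ j, taggedRates i mu x j = x + ((N : ℝ) - 1) * mu := by
  have hN : 1 ≤ N := i.pos
  rw [taggedRates, Finset.sum_update_of_mem (Finset.mem_univ i), Finset.sum_const, nsmul_eq_mul,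
    Finset.card_sdiff_of_subset (Finset.subset_univ _)]
  simp [Nat.cast_sub hN]

theorem mmnBusyWeight_taggedRates_of_notMem {B : Finset (Fin N)} (hi : i ∉ B) :
    mmnBusyWeight lam (taggedRates i mu x) B = mmnBusyWeight lam (fun _ => mu) B := by
  unfold mmnBusyWeight taggedRates
  congr 1
  refine Finset.prod_congr rfl fun j hj => ?_
  rw [Function.update_of_ne]
  rintro rfl
  exact hi hj

theorem mmnBusyWeight_taggedRates_of_mem (hmu : 0 < mu) {B : Finset (Fin N)} (hi : i ∈ B) :
    mmnBusyWeight lam (taggedRates i mu x) B = mu / x * mmnBusyWeight lam (fun _ => mu) B := by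
  unfold mmnBusyWeight taggedRates
  rw [← Finset.mul_prod_erase B _ hi, ← Finset.mul_prod_erase B (fun _ => lam / mu) hi,
    Finset.prod_congr rfl (g := fun _ => lam / mu)
      (fun j hj => by rw [Function.update_of_ne (Finset.ne_of_mem_erase hj)]),
    Function.update_self]
  field_simp

theorem taggedRateInf_lt (hx : taggedRateInf N lam mu < x) :
    0 < x ∧ lam < x + ((N : ℝ) - 1) * mu := by
  unfold taggedRateInf at hx
  obtain ⟨h1, h2⟩ := max_lt_iff.1 hx
  exact ⟨h2, by linarith⟩

/-- Pairing each `B` without `i` with `insert i B` gives the total weight `a + mu k / x + mu lam l /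
(x y)`, of which `a` is the idle part. Multiplying through by `x y / a` produces `b` and `e`. -/
theorem exists_taggedIdle_eq (i : Fin N) (hlam : 0 < lam) (hmu : 0 < mu) :
    ∃ b e : ℝ, 0 < b ∧ 0 < e ∧ ∀ x, taggedRateInf N lam mu < x →
      taggedIdle lam mu i x = x * (x - (lam - ((N : ℝ) - 1) * mu)) /
        (x * (x - (lam - ((N : ℝ) - 1) * mu)) + b * (x - (lam - ((N : ℝ) - 1) * mu)) + e) := by
  have : NeZero N := ⟨i.pos.ne'⟩
  have hw : ∀ B, 0 < mmnBusyWeight lam (fun _ : Fin N => mu) B :=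
    mmnBusyWeight_pos hlam fun _ => hmu
  set 𝓑 := (Finset.univ.erase i).powerset
  have hne : 𝓑.Nonempty := ⟨∅, Finset.empty_mem_powerset _⟩
  set a := ∑ B ∈ 𝓑, mmnBusyWeight lam (fun _ => mu) B with ha
  set k := ∑ B ∈ 𝓑, mmnBusyWeight lam (fun _ => mu) (insert i B) with hk
  set l := mmnBusyWeight lam (fun _ : Fin N => mu) Finset.univ with hl
  have ha0 : 0 < a := Finset.sum_pos (fun B _ => hw B) hne
  have hk0 : 0 < k := Finset.sum_pos (fun B _ => hw _) hne
  have hl0 : 0 < l := hw _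
  have hmem : ∀ B ∈ 𝓑, i ∉ B := fun B hB h =>
    Finset.notMem_erase i _ (Finset.mem_powerset.1 hB h)
  refine ⟨mu * k / a, mu * lam * l / a, div_pos (mul_pos hmu hk0) ha0,
    div_pos (mul_pos (mul_pos hmu hlam) hl0) ha0, fun x hx => ?_⟩
  obtain ⟨hx0, hstab⟩ := taggedRateInf_lt hx
  set y := x - (lam - ((N : ℝ) - 1) * mu) with hy
  have hy0 : 0 < y := by linarith
  have hidle : ∑ B ∈ 𝓑, mmnBusyWeight lam (taggedRates i mu x) B = a :=
    Finset.sum_congr rfl fun B hB => mmnBusyWeight_taggedRates_of_notMem (hmem B hB)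
  have hall : ∑ B, mmnBusyWeight lam (taggedRates i mu x) B = a + mu / x * k := by
    rw [← Finset.powerset_univ, ← Finset.insert_erase (Finset.mem_univ i),
      Finset.sum_powerset_insert (Finset.notMem_erase i _), hidle, hk, Finset.mul_sum]
    congr 1
    exact Finset.sum_congr rfl fun B _ =>
      mmnBusyWeight_taggedRates_of_mem hmu (Finset.mem_insert_self i B)
  have htot : mmnTotalWeight lam (taggedRates i mu x) = a + mu / x * k + mu / x * l * (lam / y) := by
    rw [mmnTotalWeight, hall, mmnBusyWeight_taggedRates_of_mem hmu (Finset.mem_univ i),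
      sum_taggedRates, ← hl, hy, sub_sub_eq_add_sub, add_sub_right_comm]
  rw [taggedIdle, mmnIdle_eq hlam (taggedRates_pos hmu hx0) (by rwa [sum_taggedRates]) i, hidle,
    htot]
  field_simp

end Tagged

theorem theorem3 (N : ℕ) (i : Fin N) (lam mu : ℝ) (hlam : 0 < lam) (hmu : lam / (N : ℝ) < mu) :
    (∀ x : ℝ, taggedRateInf N lam mu < x →
      ∃! p : MMNState N → ℝ, IsStationaryDistribution (mmnRate lam (taggedRates i mu x)) p) ∧
    ContDiffOn ℝ 3 (taggedIdle lam mu i) (Set.Ioi (taggedRateInf N lam mu)) ∧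
    (∃ xd : ℝ, taggedRateInf N lam mu ≤ xd ∧
      (∀ x : ℝ, taggedRateInf N lam mu < x → x < xd →
        0 < iteratedDeriv 2 (taggedIdle lam mu i) x) ∧
      (∀ x : ℝ, xd < x → iteratedDeriv 2 (taggedIdle lam mu i) x < 0)) ∧
    (∀ x : ℝ, taggedRateInf N lam mu < x →
      0 < iteratedDeriv 2 (taggedIdle lam mu i) x →
        iteratedDeriv 3 (taggedIdle lam mu i) x < 0) := by
  have : NeZero N := ⟨i.pos.ne'⟩
  have hmu0 : 0 < mu := (div_nonneg hlam.le (Nat.cast_nonneg N)).trans_lt hmu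
  refine ⟨fun x hx => ?_, ?_⟩
  · obtain ⟨hx0, hstab⟩ := taggedRateInf_lt hx
    exact mmn_existsUnique_stationary hlam (taggedRates_pos hmu0 hx0) (by rwa [sum_taggedRates])
  · obtain ⟨b, e, hb, he, hI⟩ := exists_taggedIdle_eq i hlam hmu0
    set c := lam - ((N : ℝ) - 1) * mu with hc
    -- If `0 ≤ c`, then `y = t` and `x = t + c`, so `g = c` and `d = e`; if `c ≤ 0`, then `x = t`
    -- and `y = t - c`, so `g = -c` and `b y` adds `b * -c` to the constant term.
    rcases le_total 0 c with h | h
    · have hm : taggedRateInf N lam mu = c := max_eq_left h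
      rw [hm] at hI ⊢
      refine rational_idle_shape hb he h fun x hx => ?_
      rw [hI x hx]
      congr 1 <;> ring
    · have hm : taggedRateInf N lam mu = 0 := max_eq_right h
      rw [hm] at hI ⊢
      refine rational_idle_shape (d := e + b * -c) (g := -c) hb
        (add_pos_of_pos_of_nonneg he (mul_nonneg hb.le (by linarith))) (by linarith) fun x hx => ?_
      rw [hI x hx]
      congr 1 <;> ring
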